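/- Let $d\ge 1$ and let $\Delta x>0$ be a grid size; for $\alpha\in\mathbb{Z}^d$ put $x_\alpha=\alpha\,\Delta x\in\mathbb{R}^d$, and for $f\colon\mathbb{Z}^d\to\mathbb{R}$ and $j=1,\dots,d$ put $\nabla_+^jf_\alpha=(f_{\alpha+e_j}-f_\alpha)/\Delta x$ and $\nabla_-^jf_\alpha=(f_\alpha-f_{\alpha-e_j})/\Delta x$. Let $c=(c^1,\dots,c^d)$ be a bounded family of coefficients $c^j_\alpha$, $\alpha\in\mathbb{Z}^d$, with $m:=\inf_{\alpha,j}c^j_\alpha>0$ and $\overline{c}:=\sup_{\alpha,j}c^j_\alpha<\infty$, that is Lipschitz: there is a constant $L$ with $|c^j_\alpha-c^j_\beta|\le L\,|x_\alpha-x_\beta|$ for all $\alpha,\beta\in\mathbb{Z}^d$ and all $j$ (Euclidean norm). For fixed $\beta\in\mathbb{Z}^d$ let $(\alpha,t)\mapsto a_{\alpha,\beta}(t)$ be the fundamental solution of the equation with coefficients frozen at $\beta$, i.e. the unique solution, bounded on $\mathbb{Z}^d\times[0,T]$ for each $T$ and continuous in $t\ge 0$, of $$\frac{d}{dt}a_{\alpha,\beta}(t)=\sum_{j=1}^d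 c^j_\beta\,\nabla_+^j\nabla_-^j a_{\alpha,\beta}(t)\quad(t>0),\qquad a_{\alpha,\beta}(0)=(\Delta x)^{-d}\,\mathbf{1}_{\{\alpha=0\}},$$ where the difference operators act on the index $\alpha$. Define $$K_{\alpha,\beta}(t)=\sum_{j=1}^d\bigl(c^j_\alpha-c^j_\beta\bigr)\,\nabla_+^j\nabla_-^j\,a_{\alpha-\beta,\beta}(t),$$ the differences again acting on $\alpha$, and let $Z(\alpha)$ denote the number of zero entries of $\alpha\in\mathbb{Z}^d$. Then for all $\alpha,\beta\in\mathbb{Z}^d$ and all $t>0$, $$|K_{\alpha,\beta}(t)|\le A\,\Bigl(\frac{1}{\sqrt{2\overline{c}}}\wedge\frac{t^{1/2}}{\Delta x}\Bigr)^{Z(\alpha-\beta)}\,t^{-(d+1)/2}\prod_{j=1}^d\Bigl(1+\frac{|x^j_\alpha-x^j_\beta|^2}{2\overline{c}\,t}\Bigr)^{-1},$$ where the constant $A$ is independent of $\alpha$, $\beta$, $\Delta x$ and $t$: it depends only on $d$, on a positive lower bound and an upper bound for the coefficients, and on $L$. -/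

import Mathlib

noncomputable section

namespace SemiDiscreteHeat

/-- The grid point `x_α = α h` in Euclidean space, where `h = Δx` is the grid size. -/
def gridPoint {d : ℕ} (h : ℝ) (α : Fin d → ℤ) : EuclideanSpace ℝ (Fin d) :=
  WithLp.toLp 2 (fun j => (α j : ℝ) * h)

/-- Forward difference in direction `j`: `(f (α + e_j) - f α) / h`. -/
def fwdDiff {d : ℕ} (h : ℝ) (j : Fin d) (f : (Fin d → ℤ) → ℝ) (α : Fin d → ℤ) : ℝ :=
  (f (α + Pi.single j 1) - f α) / h

/-- Backward difference in direction `j`: `(f α - f (α - e_j)) / h`. -/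
def bwdDiff {d : ℕ} (h : ℝ) (j : Fin d) (f : (Fin d → ℤ) → ℝ) (α : Fin d → ℤ) : ℝ :=
  (f α - f (α - Pi.single j 1)) / h

/-- The constant coefficient operator `∑ j, κ^j ∇₊^j ∇₋^j`. -/
def constOp {d : ℕ} (h : ℝ) (κ : Fin d → ℝ) (f : (Fin d → ℤ) → ℝ) (α : Fin d → ℤ) : ℝ :=
  ∑ j, κ j * fwdDiff h j (bwdDiff h j f) α

/-- The discrete Dirac measure `h ^ (-d) 1_{α = 0}`. -/
def dirac {d : ℕ} (h : ℝ) (α : Fin d → ℤ) : ℝ :=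
  if α = 0 then (h ^ d)⁻¹ else 0

/-- `a` (a function of time and of the grid index) is a fundamental solution of the
semi-discrete heat equation `∂ₜ u = ∑ j, κ^j ∇₊^j ∇₋^j u`: it solves the equation for
`t > 0`, attains the discrete Dirac measure continuously at `t = 0`, and is bounded on
`[0, T] × ℤ^d` for every `T`. Values at negative times are irrelevant. -/
structure IsFundamentalSolution {d : ℕ} (h : ℝ) (κ : Fin d → ℝ)
    (a : ℝ → (Fin d → ℤ) → ℝ) : Prop where
  initial : ∀ α, a 0 α = dirac h α
  continuousOn : ∀ α, ContinuousOn (fun t => a t α) (Set.Ici 0)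
  equation : ∀ t, 0 < t → ∀ α, HasDerivAt (fun s => a s α) (constOp h κ (a t) α) t
  bounded : ∀ T : ℝ, ∃ B : ℝ, ∀ t ∈ Set.Icc 0 T, ∀ α, |a t α| ≤ B

/-- A bound for the norm of `constOp` on bounded sequences. -/
def opBound {d : ℕ} (h : ℝ) (κ : Fin d → ℝ) : ℝ := ∑ j, |κ j| * (4 / h ^ 2)

theorem opBound_nonneg {d : ℕ} (h : ℝ) (κ : Fin d → ℝ) : 0 ≤ opBound h κ :=
  Finset.sum_nonneg fun j _ => by positivity

theorem abs_constOp_le {d : ℕ} (h : ℝ) (κ : Fin d → ℝ) (f : (Fin d → ℤ) → ℝ) (B : ℝ)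
    (hB : ∀ α, |f α| ≤ B) (α : Fin d → ℤ) : |constOp h κ f α| ≤ opBound h κ * B := by
  unfold constOp opBound
  rw [Finset.sum_mul]
  refine (Finset.abs_sum_le_sum_abs _ _).trans (Finset.sum_le_sum fun j _ => ?_)
  rw [abs_mul, mul_assoc]
  refine mul_le_mul_of_nonneg_left ?_ (abs_nonneg _)
  have e : fwdDiff h j (bwdDiff h j f) α =
      (f (α + Pi.single j 1) - f α - (f α - f (α - Pi.single j 1))) / h ^ 2 := by
    simp only [fwdDiff, bwdDiff, add_sub_cancel_right]
    rw [← sub_div, div_div, pow_two]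
  rw [e, abs_div, abs_of_nonneg (sq_nonneg h), div_mul_eq_mul_div]
  refine div_le_div_of_nonneg_right ?_ (sq_nonneg h)
  have h1 := abs_le.1 (hB (α + Pi.single j 1))
  have h2 := abs_le.1 (hB α)
  have h3 := abs_le.1 (hB (α - Pi.single j 1))
  rw [abs_le]
  constructor <;> linarith [h1.1, h1.2, h2.1, h2.2, h3.1, h3.2]

theorem constOp_add {d : ℕ} (h : ℝ) (κ : Fin d → ℝ) (f g : (Fin d → ℤ) → ℝ)
    (α : Fin d → ℤ) : constOp h κ (f + g) α = constOp h κ f α + constOp h κ g α := by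
  simp only [constOp, fwdDiff, bwdDiff, Pi.add_apply, ← Finset.sum_add_distrib]
  exact Finset.sum_congr rfl fun j _ => by ring

theorem constOp_smul {d : ℕ} (h : ℝ) (κ : Fin d → ℝ) (r : ℝ) (f : (Fin d → ℤ) → ℝ)
    (α : Fin d → ℤ) : constOp h κ (r • f) α = r * constOp h κ f α := by
  simp only [constOp, fwdDiff, bwdDiff, Pi.smul_apply, smul_eq_mul, Finset.mul_sum]
  exact Finset.sum_congr rfl fun j _ => by ring

theorem hasDerivAt_exp_apply {E : Type*} [NormedAddCommGroup E] [NormedSpace ℝ E]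
    [CompleteSpace E] (A : E →L[ℝ] E) (v : E) (t : ℝ) :
    HasDerivAt (fun s : ℝ => NormedSpace.exp (s • A) v) (A (NormedSpace.exp (t • A) v)) t := by
  simpa using (hasDerivAt_exp_smul_const' (𝕂 := ℝ) A t).clm_apply (hasDerivAt_const t v)

theorem exists_flow {E : Type*} [NormedAddCommGroup E] [NormedSpace ℝ E]
    [CompleteSpace E] (A : E →L[ℝ] E) (v : E) :
    ∃ u : ℝ → E, u 0 = v ∧ ∀ t, HasDerivAt u (A (u t)) t :=
  ⟨_, by simp, hasDerivAt_exp_apply A v⟩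

open BoundedContinuousFunction in
theorem exists_isFundamentalSolution {d : ℕ} (h : ℝ) (κ : Fin d → ℝ) :
    ∃ a, IsFundamentalSolution h κ a := by
  let A₀ : ((Fin d → ℤ) →ᵇ ℝ) →ₗ[ℝ] ((Fin d → ℤ) →ᵇ ℝ) :=
    { toFun := fun f => BoundedContinuousFunction.ofNormedAddCommGroup (constOp h κ f)
        continuous_of_discreteTopology (opBound h κ * ‖f‖)
        (fun α => abs_constOp_le h κ f ‖f‖ (fun α => f.norm_coe_le_norm α) α)
      map_add' := fun f g => by ext α; exact constOp_add h κ f g α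
      map_smul' := fun r f => by ext α; exact constOp_smul h κ r f α }
  let A : ((Fin d → ℤ) →ᵇ ℝ) →L[ℝ] ((Fin d → ℤ) →ᵇ ℝ) :=
    A₀.mkContinuous (opBound h κ) fun f => by
      refine (norm_le (mul_nonneg (opBound_nonneg h κ) (norm_nonneg f))).2 fun α => ?_
      exact abs_constOp_le h κ f ‖f‖ (fun α => f.norm_coe_le_norm α) α
  let δ : (Fin d → ℤ) →ᵇ ℝ :=
    BoundedContinuousFunction.ofNormedAddCommGroup (dirac h)
      continuous_of_discreteTopology |(h ^ d)⁻¹| (fun α => by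
        unfold dirac
        split_ifs
        · exact le_rfl
        · simp)
  obtain ⟨u, hu0, hu⟩ := exists_flow A δ
  have hd : ∀ t α, HasDerivAt (fun s => u s α) (constOp h κ (u t) α) t := fun t α =>
    ((evalCLM ℝ α : ((Fin d → ℤ) →ᵇ ℝ) →L[ℝ] ℝ).hasFDerivAt (x := u t)).comp_hasDerivAt t (hu t)
  refine ⟨fun t => u t, ⟨fun α => ?_, fun α t _ => ?_, fun t _ α => hd t α, fun T => ?_⟩⟩
  · simp [hu0, δ]
  · exact (hd t α).continuousAt.continuousWithinAt
  · have hc : Continuous u := continuous_iff_continuousAt.2 fun t => (hu t).continuousAt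
    obtain ⟨B, hB⟩ := (isCompact_Icc (a := (0 : ℝ)) (b := T)).exists_bound_of_continuousOn
      hc.continuousOn
    exact ⟨B, fun t ht α => ((u t).norm_coe_le_norm α).trans (hB t ht)⟩

theorem IsFundamentalSolution.unique {d : ℕ} {h : ℝ} {κ : Fin d → ℝ}
    {a b : ℝ → (Fin d → ℤ) → ℝ} (ha : IsFundamentalSolution h κ a)
    (hb : IsFundamentalSolution h κ b) (t : ℝ) (ht : 0 ≤ t) (α : Fin d → ℤ) :
    a t α = b t α := by
  obtain ⟨Ba, hBa⟩ := ha.bounded t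
  obtain ⟨Bb, hBb⟩ := hb.bounded t
  set k := opBound h κ with hk
  have hder : ∀ s, 0 < s → ∀ α, HasDerivAt (fun s => a s α - b s α)
      (constOp h κ (fun γ => a s γ - b s γ) α) s := fun s hs α => by
    refine ((ha.equation s hs α).sub (hb.equation s hs α)).congr_deriv ?_
    have e : (fun γ => a s γ - b s γ) = a s + (-1 : ℝ) • b s := by
      ext γ; simp [sub_eq_add_neg]
    rw [e, constOp_add, constOp_smul]; ring
  have hcont : ∀ α, ContinuousOn (fun s => a s α - b s α) (Set.Ici 0) := fun α =>
    (ha.continuousOn α).sub (hb.continuousOn α)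
  have key : ∀ n : ℕ, ∀ s ∈ Set.Icc 0 t, ∀ α,
      |a s α - b s α| ≤ (Ba + Bb) * ((k * s) ^ n / n.factorial) := by
    intro n
    induction n with
    | zero =>
      intro s hs α
      have h1 := abs_le.1 (hBa s hs α)
      have h2 := abs_le.1 (hBb s hs α)
      simp only [pow_zero, Nat.factorial_zero, Nat.cast_one, div_one, mul_one]
      rw [abs_le]
      constructor <;> linarith [h1.1, h1.2, h2.1, h2.2]
    | succ n ih =>
      intro s hs α
      have hBder : ∀ x : ℝ, HasDerivAt
          (fun x => (Ba + Bb) * ((k * x) ^ (n + 1) / (n + 1).factorial))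
          (k * ((Ba + Bb) * ((k * x) ^ n / n.factorial))) x := fun x => by
        have h1 : HasDerivAt (fun x : ℝ => k * x) k x := by
          simpa using (hasDerivAt_id x).const_mul k
        refine (((h1.pow (n + 1)).div_const _).const_mul (Ba + Bb)).congr_deriv ?_
        rw [Nat.factorial_succ]
        push_cast
        have : (n.factorial : ℝ) ≠ 0 := by positivity
        have : (n : ℝ) + 1 ≠ 0 := by positivity
        field_simp
      have hle : ∀ x ∈ interior (Set.Icc 0 t), |constOp h κ (fun γ => a x γ - b x γ) α| ≤
          k * ((Ba + Bb) * ((k * x) ^ n / n.factorial)) := fun x hx =>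
        abs_constOp_le h κ _ _ (ih x (interior_subset hx)) α
      have mono : ∀ σ : ℝ, |σ| ≤ 1 → MonotoneOn (fun x =>
          (Ba + Bb) * ((k * x) ^ (n + 1) / (n + 1).factorial) + σ * (a x α - b x α))
          (Set.Icc 0 t) := fun σ hσ => by
        refine monotoneOn_of_hasDerivWithinAt_nonneg (convex_Icc 0 t)
          (f' := fun x => k * ((Ba + Bb) * ((k * x) ^ n / n.factorial)) +
            σ * constOp h κ (fun γ => a x γ - b x γ) α) ?_ ?_ ?_
        · refine ContinuousOn.add (fun x _ => (hBder x).continuousAt.continuousWithinAt) ?_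
          exact continuousOn_const.mul ((hcont α).mono Set.Icc_subset_Ici_self)
        · intro x hx
          have hx' : 0 < x := by rw [interior_Icc] at hx; exact hx.1
          exact ((hBder x).add ((hder x hx' α).const_mul σ)).hasDerivWithinAt
        · intro x hx
          have h1 := hle x hx
          have h2 : |σ * constOp h κ (fun γ => a x γ - b x γ) α| ≤
              |constOp h κ (fun γ => a x γ - b x γ) α| := by
            rw [abs_mul]; exact mul_le_of_le_one_left (abs_nonneg _) hσ
          linarith [(abs_le.1 (h2.trans h1)).1]
      have h0 : a 0 α - b 0 α = 0 := by rw [ha.initial, hb.initial, sub_self]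
      have m0 : (0 : ℝ) ∈ Set.Icc 0 t := ⟨le_rfl, ht⟩
      have p := mono 1 (by simp) m0 hs hs.1
      have q := mono (-1) (by simp) m0 hs hs.1
      simp only [h0, mul_zero, zero_pow (Nat.succ_ne_zero n), zero_div, add_zero] at p q
      rw [abs_le]
      constructor <;> linarith
  have hlim : Filter.Tendsto (fun n : ℕ => (Ba + Bb) * ((k * t) ^ n / n.factorial))
      Filter.atTop (nhds 0) := by
    simpa using (FloorSemiring.tendsto_pow_div_factorial_atTop (k * t)).const_mul (Ba + Bb)
  have := ge_of_tendsto' hlim fun n => key n t ⟨ht, le_rfl⟩ α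
  exact sub_eq_zero.1 (abs_nonpos_iff.1 this)

/-- The heat kernel: the fundamental solution with constant coefficients `κ`. It exists by
`exists_isFundamentalSolution` and is determined for `t ≥ 0` by
`IsFundamentalSolution.unique`. -/
def heatKernel {d : ℕ} (h : ℝ) (κ : Fin d → ℝ) : ℝ → (Fin d → ℤ) → ℝ :=
  Classical.choose (exists_isFundamentalSolution h κ)

theorem heatKernel_spec {d : ℕ} (h : ℝ) (κ : Fin d → ℝ) :
    IsFundamentalSolution h κ (heatKernel h κ) :=
  Classical.choose_spec (exists_isFundamentalSolution h κ)

/-- The error kernel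
`K_{α,β}(t) = ∑ j, (c_α^j - c_β^j) ∇₊^j ∇₋^j a_{α-β,β}(t)`, where `a_{·,β}` is the heat
kernel with coefficients frozen at `β` and the differences act on `α`. -/
def errorKernel {d : ℕ} (h : ℝ) (c : (Fin d → ℤ) → Fin d → ℝ) (α β : Fin d → ℤ)
    (t : ℝ) : ℝ :=
  ∑ j, (c α j - c β j) *
    fwdDiff h j (bwdDiff h j (fun γ => heatKernel h (c β) t (γ - β))) α

/-- `Z(α)`, the number of zero entries of `α`. -/
def numZeros {d : ℕ} (α : Fin d → ℤ) : ℕ :=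
  (Finset.univ.filter fun j => α j = 0).card

/-- `c̄`, the supremum norm of the coefficients over all indices and directions. -/
def supNorm {d : ℕ} (c : (Fin d → ℤ) → Fin d → ℝ) : ℝ :=
  ⨆ p : (Fin d → ℤ) × Fin d, |c p.1 p.2|

end SemiDiscreteHeat

end

namespace SemiDiscreteHeat

open Real MeasureTheory

/-! By uniqueness of the fundamental solution, the frozen-coefficient kernel is `h⁻ᵈ` times a
product of one-dimensional kernels on `ℤ`, taken at times `s = κ t / h²`. Each has the Fourier form
`(2π)⁻¹ ∫ cos(nθ) exp(-s(2 - 2cos θ)) dθ`, so `∇₊ʲ∇₋ʲ` touches only the `j`-th factor, and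
everything reduces to dimension one.

Write `T = √t / h`, so that `s = κ T²`. The Fourier integrals and three integrations by parts bound
the kernel and its second difference in three ways: trivially, with the parabolic decay in `s`, and
through the third moment in `n` (`exists_kernel_bounds`). Both `Y = T |kernel|` and `Y = T³
|kernelDiff|` then satisfy `Y ≤ C`, `Y ≤ C T` and `|n|³ Y ≤ C T³`. The first two give the factor
`min (1/√(2c̄)) T` in directions without displacement; the first and third give decay like the
inverse cube of `tailWeight`, the square root of the weight in the theorem
(`mul_tailWeight_pow_three_le`).

The cube is what is needed: the Lipschitz condition bounds the coefficient difference by a constant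
times `√t ∏ tailWeight` (`norm_gridPoint_sub_le`). This uses up one power of the product and turns
`t^(-(d+2)/2)` into `t^(-(d+1)/2)`; the remaining two powers are the claimed tail. -/

/-! ### Fourier symbol and Gaussian estimates -/

/-- The Fourier symbol of the negative second difference. -/
noncomputable def symbol (θ : ℝ) : ℝ := 2 - 2 * cos θ

theorem symbol_nonneg (θ : ℝ) : 0 ≤ symbol θ := by
  unfold symbol; linarith [cos_le_one θ]

theorem symbol_le_four (θ : ℝ) : symbol θ ≤ 4 := by
  unfold symbol; linarith [neg_one_le_cos θ]

theorem hasDerivAt_symbol (θ : ℝ) : HasDerivAt symbol (2 * sin θ) θ :=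
  (((hasDerivAt_cos θ).const_mul 2).const_sub 2).congr_deriv (by ring)

@[fun_prop]
theorem continuous_symbol : Continuous symbol := by
  unfold symbol; fun_prop

/-- The Fourier transform of the one-dimensional heat kernel at time `s`. -/
noncomputable def gauss (s θ : ℝ) : ℝ := exp (-(s * symbol θ))

@[fun_prop]
theorem continuous_gauss (s : ℝ) : Continuous (gauss s) := by
  unfold gauss; fun_prop

theorem gauss_pos (s θ : ℝ) : 0 < gauss s θ := exp_pos _

theorem gauss_le_one {s : ℝ} (hs : 0 ≤ s) (θ : ℝ) : gauss s θ ≤ 1 :=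
  exp_le_one_iff.2 (neg_nonpos.2 (mul_nonneg hs (symbol_nonneg θ)))

theorem hasDerivAt_gauss (s θ : ℝ) :
    HasDerivAt (gauss s) (-(2 * s * sin θ) * gauss s θ) θ :=
  (((hasDerivAt_symbol θ).const_mul s).fun_neg.exp).congr_deriv (by unfold gauss; ring)

theorem hasDerivAt_gauss_time (s θ : ℝ) :
    HasDerivAt (fun s => gauss s θ) (-(symbol θ * gauss s θ)) s :=
  (((hasDerivAt_id s).mul_const (symbol θ)).neg.exp).congr_deriv (by simp [gauss]; ring)

theorem sq_sin_le_symbol (θ : ℝ) : sin θ ^ 2 ≤ symbol θ := by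
  unfold symbol
  nlinarith [sin_sq_add_cos_sq θ, sq_nonneg (1 - cos θ)]

/-- On `[-π, π]` one has `1 - cos θ ≥ 2θ²/π²`, so the integrand lies below a true Gaussian, whose
integral over the line is explicit. This is the source of every gain of `s^(-1/2)`. -/
theorem gauss_half_integral_le {s : ℝ} (hs : 0 < s) :
    √s * ∫ θ in -π..π, gauss (s / 2) θ ≤ √(π ^ 3 / 2) := by
  have hb : 0 < 2 * s / π ^ 2 := by positivity
  have h1 : ∫ θ in -π..π, gauss (s / 2) θ ≤ ∫ θ in -π..π, exp (-(2 * s / π ^ 2) * θ ^ 2) := by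
    refine intervalIntegral.integral_mono_on (by linarith [pi_pos])
      ((continuous_gauss _).intervalIntegrable _ _)
      ((by fun_prop : Continuous _).intervalIntegrable _ _) fun θ hθ => ?_
    refine exp_le_exp.2 ?_
    have := cos_le_one_sub_mul_cos_sq (abs_le.2 hθ)
    unfold symbol
    have h3 : s * cos θ ≤ s * (1 - 2 / π ^ 2 * θ ^ 2) := mul_le_mul_of_nonneg_left this hs.le
    calc -(s / 2 * (2 - 2 * cos θ)) = s * cos θ - s := by ring
      _ ≤ s * (1 - 2 / π ^ 2 * θ ^ 2) - s := by linarith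
      _ = _ := by ring
  have h2 : ∫ θ in -π..π, exp (-(2 * s / π ^ 2) * θ ^ 2) ≤ √(π / (2 * s / π ^ 2)) := by
    rw [← integral_gaussian, intervalIntegral.integral_of_le (by linarith [pi_pos])]
    exact setIntegral_le_integral (integrable_exp_neg_mul_sq hb)
      (Filter.Eventually.of_forall fun θ => (exp_pos _).le)
  calc _ ≤ √s * √(π / (2 * s / π ^ 2)) := by gcongr; exact h1.trans h2
    _ = √(π ^ 3 / 2) := by
      rw [← sqrt_mul hs.le]; congr 1; field_simp

/-- Half of the exponent absorbs the polynomial: `y^k ≤ 1 + y^6`, and the cubic term of the series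
of `exp (y²/2)` gives `y^6 ≤ 48 exp (y²/2)`, whence 49 = 1 + 48. -/
theorem pow_mul_exp_neg_sq_le {y : ℝ} (hy : 0 ≤ y) {k : ℕ} (hk : k ≤ 6) :
    y ^ k * exp (-y ^ 2) ≤ 49 * exp (-y ^ 2 / 2) := by
  have h6 : y ^ k ≤ 1 + y ^ 6 := by
    rcases le_total y 1 with h | h
    · linarith [pow_le_one₀ (n := k) hy h, pow_nonneg hy 6]
    · linarith [pow_le_pow_right₀ h hk]
  have h1 := pow_div_factorial_le_exp (y ^ 2 / 2) (by positivity) 3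
  have h2 : 1 ≤ exp (y ^ 2 / 2) := one_le_exp (by positivity)
  have h3 : y ^ k ≤ 49 * exp (y ^ 2 / 2) := by
    have : (y ^ 2 / 2) ^ 3 / (Nat.factorial 3 : ℝ) = y ^ 6 / 48 := by
      norm_num [Nat.factorial]; ring
    linarith
  calc _ ≤ 49 * exp (y ^ 2 / 2) * exp (-y ^ 2) := by gcongr
    _ = _ := by rw [mul_assoc, ← exp_add]; ring_nf

/-! ### Integration by parts and the one-dimensional kernel -/

/-- Three integrations by parts. In the first and third the boundary terms vanish since `sin (nπ) =
0`; in the second they cancel because `f'` agrees at the two endpoints. -/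
theorem integral_cos_mul_third_deriv {f f' f'' f''' : ℝ → ℝ} (h1 : ∀ θ, HasDerivAt f (f' θ) θ)
    (h2 : ∀ θ, HasDerivAt f' (f'' θ) θ) (h3 : ∀ θ, HasDerivAt f'' (f''' θ) θ)
    (hc : Continuous f''') (hper : f' π = f' (-π)) (n : ℤ) :
    (n : ℝ) ^ 3 * ∫ θ in -π..π, cos (n * θ) * f θ = ∫ θ in -π..π, sin (n * θ) * f''' θ := by
  have c2 : Continuous f'' := continuous_iff_continuousAt.2 fun θ => (h3 θ).continuousAt
  have c1 : Continuous f' := continuous_iff_continuousAt.2 fun θ => (h2 θ).continuousAt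
  have hm : ∀ θ, HasDerivAt (fun θ : ℝ => (n : ℝ) * θ) n θ := fun θ => by
    simpa using (hasDerivAt_id θ).const_mul (n : ℝ)
  have ds : ∀ θ, HasDerivAt (fun θ : ℝ => sin (n * θ)) (n * cos (n * θ)) θ := fun θ =>
    (hm θ).sin.congr_deriv (by ring)
  have dc : ∀ θ, HasDerivAt (fun θ : ℝ => cos (n * θ)) (-(n * sin (n * θ))) θ := fun θ =>
    (hm θ).cos.congr_deriv (by ring)
  have e1 := intervalIntegral.integral_mul_deriv_eq_deriv_mul (a := -π) (b := π)
    (fun θ _ => ds θ) (fun θ _ => h1 θ)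
    ((by fun_prop : Continuous _).intervalIntegrable _ _) (c1.intervalIntegrable _ _)
  have e2 := intervalIntegral.integral_mul_deriv_eq_deriv_mul (a := -π) (b := π)
    (fun θ _ => dc θ) (fun θ _ => h2 θ)
    ((by fun_prop : Continuous _).intervalIntegrable _ _) (c2.intervalIntegrable _ _)
  have e3 := intervalIntegral.integral_mul_deriv_eq_deriv_mul (a := -π) (b := π)
    (fun θ _ => ds θ) (fun θ _ => h3 θ)
    ((by fun_prop : Continuous _).intervalIntegrable _ _) (hc.intervalIntegrable _ _)
  simp only [mul_neg, sin_neg, cos_neg, sin_int_mul_pi, neg_zero, zero_mul, zero_sub,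
    mul_assoc, neg_mul, intervalIntegral.integral_neg, intervalIntegral.integral_const_mul,
    hper, sub_self, neg_neg] at e1 e2 e3
  rw [e3, e2, pow_succ, pow_two, mul_assoc, mul_assoc, ← neg_eq_iff_eq_neg.2 e1]
  ring

/-- The one-dimensional heat kernel on `ℤ` with unit grid size and unit coefficient. -/
noncomputable def kernel (n : ℤ) (s : ℝ) : ℝ := (2 * π)⁻¹ * ∫ θ in -π..π, cos (n * θ) * gauss s θ

/-- The second difference of the one-dimensional heat kernel. -/
noncomputable def kernelDiff (n : ℤ) (s : ℝ) : ℝ := kernel (n + 1) s - 2 * kernel n s + kernel (n - 1) s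

theorem kernelDiff_eq (n : ℤ) (s : ℝ) :
    kernelDiff n s = -((2 * π)⁻¹ * ∫ θ in -π..π, cos (n * θ) * (symbol θ * gauss s θ)) := by
  have hi : ∀ k : ℤ, IntervalIntegrable (fun θ => cos (k * θ) * gauss s θ) volume (-π) π :=
    fun k => (by fun_prop : Continuous _).intervalIntegrable _ _
  unfold kernelDiff kernel
  rw [mul_left_comm, ← mul_sub, ← mul_add, ← mul_neg, ← intervalIntegral.integral_const_mul,
    ← intervalIntegral.integral_sub (hi _) ((hi _).const_mul 2),
    ← intervalIntegral.integral_add ((hi _).sub ((hi _).const_mul 2)) (hi _),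
    ← intervalIntegral.integral_neg]
  congr 2
  ext θ
  push_cast
  rw [add_mul, sub_mul, one_mul, cos_add, cos_sub]
  unfold symbol
  ring

/-- The heat equation on `ℤ`: differentiating under the integral brings down `-symbol`, the Fourier
multiplier of the second difference. The domination is local, on `|x - s| < 1`, and also covers
negative times. -/
theorem hasDerivAt_kernel (n : ℤ) (s : ℝ) : HasDerivAt (kernel n) (kernelDiff n s) s := by
  rw [kernelDiff_eq, ← mul_neg, ← intervalIntegral.integral_neg]
  have key := intervalIntegral.hasDerivAt_integral_of_dominated_loc_of_deriv_le
    (μ := volume) (a := -π) (b := π) (F := fun s θ => cos (n * θ) * gauss s θ)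
    (F' := fun s θ => -(cos (n * θ) * (symbol θ * gauss s θ))) (x₀ := s)
    (s := Metric.ball s 1) (bound := fun _ => 4 * exp (4 * (|s| + 1)))
    (Metric.ball_mem_nhds s one_pos)
    (Filter.Eventually.of_forall fun x => (by fun_prop : Continuous _).aestronglyMeasurable)
    ((by fun_prop : Continuous _).intervalIntegrable _ _)
    ((by fun_prop : Continuous _).aestronglyMeasurable)
    (Filter.Eventually.of_forall fun θ _ x hx => ?_) (by simp)
    (Filter.Eventually.of_forall fun θ _ x hx =>
      ((hasDerivAt_gauss_time x θ).const_mul (cos (n * θ))).congr_deriv (by ring))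
  · exact key.2.const_mul _
  · rw [norm_neg, norm_mul, norm_mul, norm_of_nonneg (symbol_nonneg θ),
      norm_of_nonneg (gauss_pos x θ).le]
    have h1 : ‖cos (n * θ)‖ ≤ 1 := abs_cos_le_one _
    have h2 : gauss x θ ≤ exp (4 * (|s| + 1)) := by
      refine exp_le_exp.2 ?_
      have hx' : |x - s| < 1 := by simpa [Real.dist_eq] using hx
      have h3 : |x| ≤ |s| + 1 := by
        have := abs_sub_abs_le_abs_sub x s
        linarith
      have h4 : -x * symbol θ ≤ |x| * symbol θ :=
        mul_le_mul_of_nonneg_right (neg_le_abs x) (symbol_nonneg θ)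
      have h5 : |x| * symbol θ ≤ (|s| + 1) * 4 :=
        mul_le_mul h3 (symbol_le_four θ) (symbol_nonneg θ) (by positivity)
      linarith
    calc _ ≤ 1 * (4 * exp (4 * (|s| + 1))) :=
          mul_le_mul h1 (mul_le_mul (symbol_le_four θ) h2 (gauss_pos x θ).le (by norm_num))
            (mul_nonneg (symbol_nonneg θ) (gauss_pos x θ).le) zero_le_one
      _ = _ := one_mul _

theorem kernel_zero (n : ℤ) : kernel n 0 = if n = 0 then 1 else 0 := by
  unfold kernel gauss
  split_ifs with hn
  · have := pi_ne_zero
    simp [hn]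
    field_simp
    norm_num
  · have hn' : (n : ℝ) ≠ 0 := by exact_mod_cast hn
    simp [intervalIntegral.integral_comp_mul_left _ hn', sin_int_mul_pi]

/-! ### Moment bounds for the kernel and its second difference -/

theorem abs_integral_trig_le {w f F : ℝ → ℝ} (hw : ∀ θ, |w θ| ≤ 1) (hF : Continuous F)
    (hf : ∀ θ, |f θ| ≤ F θ) : |∫ θ in -π..π, w θ * f θ| ≤ ∫ θ in -π..π, F θ := by
  have hle : ∀ θ, ‖w θ * f θ‖ ≤ F θ := fun θ => by
    rw [norm_mul]
    exact (mul_le_of_le_one_left (norm_nonneg _) (hw θ)).trans (hf θ)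
  exact intervalIntegral.norm_integral_le_of_norm_le (by linarith [pi_pos])
    (Filter.Eventually.of_forall fun θ _ => hle θ) (hF.intervalIntegrable _ _)

theorem abs_integral_trig_le_const {w f : ℝ → ℝ} {C : ℝ} (hw : ∀ θ, |w θ| ≤ 1)
    (hf : ∀ θ, |f θ| ≤ C) : |∫ θ in -π..π, w θ * f θ| ≤ 2 * π * C := by
  refine (abs_integral_trig_le hw continuous_const hf).trans (le_of_eq ?_)
  rw [intervalIntegral.integral_const, smul_eq_mul]; ring

theorem hasDerivAt_gauss_mul {s θ p' : ℝ} {p : ℝ → ℝ} (hp : HasDerivAt p p' θ) :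
    HasDerivAt (fun θ => p θ * gauss s θ) ((p' - 2 * s * sin θ * p θ) * gauss s θ) θ :=
  (hp.fun_mul (hasDerivAt_gauss s θ)).congr_deriv (by ring)

theorem pow_symbol_mul_gauss_le {s : ℝ} (hs : 0 ≤ s) (θ : ℝ) {k : ℕ} (hk : k ≤ 6) :
    (√s * √(symbol θ)) ^ k * gauss s θ ≤ 49 * gauss (s / 2) θ := by
  have e : s * symbol θ = (√s * √(symbol θ)) ^ 2 := by
    rw [mul_pow, sq_sqrt hs, sq_sqrt (symbol_nonneg θ)]
  have := pow_mul_exp_neg_sq_le (y := √s * √(symbol θ)) (by positivity) hk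
  unfold gauss
  rw [div_mul_eq_mul_div, e, ← neg_div]
  exact this

theorem kernel_third_moment (n : ℤ) (s : ℝ) :
    (n : ℝ) ^ 3 * kernel n s = (2 * π)⁻¹ * ∫ θ in -π..π, sin (n * θ) *
      ((-8 * s ^ 3 * sin θ ^ 3 + 12 * s ^ 2 * sin θ * cos θ + 2 * s * sin θ) * gauss s θ) := by
  unfold kernel
  rw [mul_left_comm]
  congr 1
  refine integral_cos_mul_third_deriv (f' := fun θ => (-(2 * s * sin θ)) * gauss s θ)
    (f'' := fun θ => (4 * s ^ 2 * sin θ ^ 2 - 2 * s * cos θ) * gauss s θ)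
    (fun θ => hasDerivAt_gauss s θ) (fun θ => ?_) (fun θ => ?_) (by fun_prop) (by simp) n
  · refine (hasDerivAt_gauss_mul (((hasDerivAt_sin θ).const_mul (2 * s)).fun_neg)).congr_deriv ?_
    ring
  · refine (hasDerivAt_gauss_mul ((((hasDerivAt_sin θ).fun_pow 2).const_mul (4 * s ^ 2)).fun_sub
      ((hasDerivAt_cos θ).const_mul (2 * s)))).congr_deriv ?_
    push_cast
    ring

theorem kernelDiff_third_moment (n : ℤ) (s : ℝ) :
    (n : ℝ) ^ 3 * kernelDiff n s = -((2 * π)⁻¹ * ∫ θ in -π..π, sin (n * θ) *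
      ((-2 * sin θ - 24 * s * sin θ * cos θ + 2 * s * symbol θ * sin θ + 24 * s ^ 2 * sin θ ^ 3
        + 12 * s ^ 2 * symbol θ * sin θ * cos θ - 8 * s ^ 3 * symbol θ * sin θ ^ 3)
        * gauss s θ)) := by
  rw [kernelDiff_eq, mul_neg, mul_left_comm]
  congr 2
  refine integral_cos_mul_third_deriv
    (f' := fun θ => (2 * sin θ - 2 * s * (symbol θ * sin θ)) * gauss s θ)
    (f'' := fun θ => (2 * cos θ - 8 * s * sin θ ^ 2 - 2 * s * (symbol θ * cos θ)
      + 4 * s ^ 2 * (symbol θ * sin θ ^ 2)) * gauss s θ)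
    (fun θ => ?_) (fun θ => ?_) (fun θ => ?_) (by fun_prop) (by simp) n
  · refine (hasDerivAt_gauss_mul (hasDerivAt_symbol θ)).congr_deriv ?_
    ring
  · refine (hasDerivAt_gauss_mul (((hasDerivAt_sin θ).const_mul 2).fun_sub
      (((hasDerivAt_symbol θ).fun_mul (hasDerivAt_sin θ)).const_mul (2 * s)))).congr_deriv ?_
    ring
  · refine (hasDerivAt_gauss_mul (((((hasDerivAt_cos θ).const_mul 2).fun_sub
      (((hasDerivAt_sin θ).fun_pow 2).const_mul (8 * s))).fun_sub
      (((hasDerivAt_symbol θ).fun_mul (hasDerivAt_cos θ)).const_mul (2 * s))).fun_add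
      (((hasDerivAt_symbol θ).fun_mul ((hasDerivAt_sin θ).fun_pow 2)).const_mul
        (4 * s ^ 2)))).congr_deriv ?_
    push_cast
    ring

theorem abs_sin_le_sqrt_symbol (θ : ℝ) : |sin θ| ≤ √(symbol θ) :=
  abs_le_sqrt (sq_sin_le_symbol θ)

/-- With `|sin θ| ≤ u = √(symbol θ)` and `r = √s`, each power of `r u` is absorbed by half of the
exponential. What is left integrates to `O(s)`, as `s √s` meets an integral of order `s^(-1/2)`. -/
theorem kernel_third_integrand_le {s : ℝ} (hs : 0 ≤ s) (θ : ℝ) :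
    |(-8 * s ^ 3 * sin θ ^ 3 + 12 * s ^ 2 * sin θ * cos θ + 2 * s * sin θ) * gauss s θ| ≤
      980 * (s * √s) * gauss (s / 2) θ + 2 * s := by
  have hg := gauss_pos s θ
  have hg1 := gauss_le_one hs θ
  have hu := abs_sin_le_sqrt_symbol θ
  have h3 := pow_symbol_mul_gauss_le hs θ (k := 3) (by norm_num)
  have h1 := pow_symbol_mul_gauss_le hs θ (k := 1) (by norm_num)
  set u := √(symbol θ)
  set r := √s
  have hr : s = r ^ 2 := (sq_sqrt hs).symm
  have hr0 : 0 ≤ r := sqrt_nonneg s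
  have hu0 : 0 ≤ u := sqrt_nonneg _
  have t1 : |-8 * s ^ 3 * sin θ ^ 3| ≤ 8 * s ^ 3 * u ^ 3 := by
    rw [abs_mul, abs_mul, abs_of_nonneg (pow_nonneg hs 3), abs_pow]
    norm_num
    gcongr
  have t2 : |12 * s ^ 2 * sin θ * cos θ| ≤ 12 * s ^ 2 * u := by
    rw [abs_mul, abs_mul, abs_of_nonneg (by positivity : 0 ≤ 12 * s ^ 2)]
    calc _ ≤ 12 * s ^ 2 * u * 1 := by gcongr; exact abs_cos_le_one θ
      _ = _ := mul_one _
  -- Here `|sin θ| ≤ 1` is used in place of `u`: absorbing a factor `r u` would leave only `√s` in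
  -- front, and the integrated bound would not be `O(s)` for small `s`.
  have t3 : |2 * s * sin θ| ≤ 2 * s := by
    rw [abs_mul, abs_of_nonneg (by positivity : 0 ≤ 2 * s)]
    exact mul_le_of_le_one_right (by positivity) (abs_sin_le_one θ)
  rw [abs_mul, abs_of_pos hg]
  calc _ ≤ (8 * s ^ 3 * u ^ 3 + 12 * s ^ 2 * u + 2 * s) * gauss s θ := by
        gcongr
        exact (abs_add_three _ _ _).trans (by gcongr)
    _ = 8 * (s * r) * ((r * u) ^ 3 * gauss s θ) + 12 * (s * r) * ((r * u) ^ 1 * gauss s θ)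
        + 2 * s * gauss s θ := by rw [hr]; ring
    _ ≤ 8 * (s * r) * (49 * gauss (s / 2) θ) + 12 * (s * r) * (49 * gauss (s / 2) θ)
        + 2 * s * 1 := by gcongr
    _ = _ := by ring

theorem kernelDiff_third_integrand_le {s : ℝ} (hs : 0 ≤ s) (θ : ℝ) :
    |(-2 * sin θ - 24 * s * sin θ * cos θ + 2 * s * symbol θ * sin θ + 24 * s ^ 2 * sin θ ^ 3
        + 12 * s ^ 2 * symbol θ * sin θ * cos θ - 8 * s ^ 3 * symbol θ * sin θ ^ 3) * gauss s θ| ≤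
      3332 * √s * gauss (s / 2) θ + 100 := by
  have hg := gauss_pos s θ
  have hg1 := gauss_le_one hs θ
  have hu := abs_sin_le_sqrt_symbol θ
  have h5 := pow_symbol_mul_gauss_le hs θ (k := 5) (by norm_num)
  have h3 := pow_symbol_mul_gauss_le hs θ (k := 3) (by norm_num)
  have h2 := pow_symbol_mul_gauss_le hs θ (k := 2) (by norm_num)
  have h1 := pow_symbol_mul_gauss_le hs θ (k := 1) (by norm_num)
  have hh := gauss_le_one (s := s / 2) (by positivity) θ
  have hv : symbol θ = √(symbol θ) ^ 2 := (sq_sqrt (symbol_nonneg θ)).symm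
  set u := √(symbol θ)
  set r := √s
  have hr : s = r ^ 2 := (sq_sqrt hs).symm
  have hr0 : 0 ≤ r := sqrt_nonneg s
  have hu0 : 0 ≤ u := sqrt_nonneg _
  have hc := abs_cos_le_one θ
  have h1s := abs_sin_le_one θ
  have t0 : |-2 * sin θ| ≤ 2 := by
    rw [abs_mul]; norm_num; exact h1s
  have t1 : |24 * s * sin θ * cos θ| ≤ 24 * s * u := by
    rw [abs_mul, abs_mul, abs_of_nonneg (by positivity : 0 ≤ 24 * s)]
    calc _ ≤ 24 * s * u * 1 := by gcongr
      _ = _ := mul_one _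
  -- The sine is bounded by 1 because `s u³ = (r u)³ / r` would be singular as `s → 0`.
  have t2 : |2 * s * symbol θ * sin θ| ≤ 2 * s * u ^ 2 := by
    rw [hv, abs_mul, abs_of_nonneg (by positivity : 0 ≤ 2 * s * u ^ 2)]
    exact mul_le_of_le_one_right (by positivity) h1s
  have t3 : |24 * s ^ 2 * sin θ ^ 3| ≤ 24 * s ^ 2 * u ^ 3 := by
    rw [abs_mul, abs_of_nonneg (by positivity : 0 ≤ 24 * s ^ 2), abs_pow]
    gcongr
  have t4 : |12 * s ^ 2 * symbol θ * sin θ * cos θ| ≤ 12 * s ^ 2 * u ^ 3 := by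
    rw [hv, abs_mul, abs_mul, abs_of_nonneg (by positivity : 0 ≤ 12 * s ^ 2 * u ^ 2)]
    calc _ ≤ 12 * s ^ 2 * u ^ 2 * u * 1 := by gcongr
      _ = _ := by ring
  have t5 : |8 * s ^ 3 * symbol θ * sin θ ^ 3| ≤ 8 * s ^ 3 * u ^ 5 := by
    rw [hv, abs_mul, abs_of_nonneg (by positivity : 0 ≤ 8 * s ^ 3 * u ^ 2), abs_pow]
    calc _ ≤ 8 * s ^ 3 * u ^ 2 * u ^ 3 := by gcongr
      _ = _ := by ring
  rw [abs_mul, abs_of_pos hg]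
  calc _ ≤ (2 + 24 * s * u + 2 * s * u ^ 2 + 24 * s ^ 2 * u ^ 3 + 12 * s ^ 2 * u ^ 3
          + 8 * s ^ 3 * u ^ 5) * gauss s θ := by
        gcongr
        refine (abs_sub _ _).trans (add_le_add ?_ t5)
        refine (abs_add_le _ _).trans (add_le_add ?_ t4)
        refine (abs_add_le _ _).trans (add_le_add ?_ t3)
        refine (abs_add_le _ _).trans (add_le_add ?_ t2)
        exact (abs_sub _ _).trans (add_le_add t0 t1)
    _ = 2 * gauss s θ + 24 * r * ((r * u) ^ 1 * gauss s θ) + 2 * ((r * u) ^ 2 * gauss s θ)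
        + 24 * r * ((r * u) ^ 3 * gauss s θ) + 12 * r * ((r * u) ^ 3 * gauss s θ)
        + 8 * r * ((r * u) ^ 5 * gauss s θ) := by rw [hr]; ring
    -- Here 3332 = 49 (24 + 24 + 12 + 8) and 100 = 2 + 2 · 49.
    _ ≤ 2 * 1 + 24 * r * (49 * gauss (s / 2) θ) + 2 * (49 * 1)
        + 24 * r * (49 * gauss (s / 2) θ) + 12 * r * (49 * gauss (s / 2) θ)
        + 8 * r * (49 * gauss (s / 2) θ) := by
      have h2' : (r * u) ^ 2 * gauss s θ ≤ 49 * 1 := h2.trans (by gcongr)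
      gcongr
    _ = _ := by ring

/-- Uniform bounds for the one-dimensional heat kernel and its second difference. -/
theorem exists_kernel_bounds : ∃ C : ℝ, 1 ≤ C ∧ ∀ (n : ℤ) (s : ℝ), 0 < s →
    |kernel n s| ≤ 1 ∧ √s * |kernel n s| ≤ C ∧ |(n : ℝ)| ^ 3 * |kernel n s| ≤ C * s ∧
    s * |kernelDiff n s| ≤ 1 ∧ s * √s * |kernelDiff n s| ≤ C ∧
    |(n : ℝ)| ^ 3 * |kernelDiff n s| ≤ C := by
  set Γ := √(π ^ 3 / 2)
  have hΓ : 0 ≤ Γ := sqrt_nonneg _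
  refine ⟨3332 * Γ + 100, by linarith, fun n s hs => ?_⟩
  have hpi : 0 < 2 * π := by positivity
  have hpi1 : (2 * π)⁻¹ ≤ 1 := inv_le_one_of_one_le₀ (by linarith [pi_gt_three])
  have hcos : ∀ θ : ℝ, |cos (n * θ)| ≤ 1 := fun θ => abs_cos_le_one _
  have hsin : ∀ θ : ℝ, |sin (n * θ)| ≤ 1 := fun θ => abs_sin_le_one _
  have hG := gauss_half_integral_le hs
  have hr : 0 < √s := sqrt_pos.2 hs
  set I := ∫ θ in -π..π, gauss (s / 2) θ
  have hI : ∀ a b : ℝ, ∫ θ in -π..π, (a * gauss (s / 2) θ + b) = a * I + b * (2 * π) := by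
    intro a b
    rw [intervalIntegral.integral_add ((by fun_prop : Continuous _).intervalIntegrable _ _)
      (by simp), intervalIntegral.integral_const_mul, intervalIntegral.integral_const,
      smul_eq_mul]
    ring
  have hI0 : 0 ≤ I := intervalIntegral.integral_nonneg (by linarith [pi_pos])
    fun θ _ => (gauss_pos _ θ).le
  have habs : ∀ x : ℝ, |(2 * π)⁻¹ * x| = (2 * π)⁻¹ * |x| := fun x => by
    rw [abs_mul, abs_of_pos (inv_pos.2 hpi)]
  have hle : ∀ a b : ℝ, 0 ≤ a → (2 * π)⁻¹ * (a * I + b * (2 * π)) ≤ a * I + b := by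
    intro a b ha
    have : (2 * π)⁻¹ * (a * I + b * (2 * π)) = (2 * π)⁻¹ * (a * I) + b := by field_simp
    rw [this]
    exact add_le_add_left (mul_le_of_le_one_left (mul_nonneg ha hI0) hpi1) b
  have hone : ∀ f : ℝ → ℝ, (∀ θ, |f θ| ≤ 1) →
      (2 * π)⁻¹ * |∫ θ in -π..π, cos (n * θ) * f θ| ≤ 1 := fun f hf => by
    have := abs_integral_trig_le_const hcos hf
    rw [mul_one] at this
    calc _ ≤ (2 * π)⁻¹ * (2 * π) := by gcongr
      _ = 1 := inv_mul_cancel₀ hpi.ne'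
  have hlin : ∀ w f : ℝ → ℝ, ∀ a b : ℝ, 0 ≤ a → (∀ θ, |w θ| ≤ 1) →
      (∀ θ, |f θ| ≤ a * gauss (s / 2) θ + b) →
      (2 * π)⁻¹ * |∫ θ in -π..π, w θ * f θ| ≤ a * I + b := fun w f a b ha hw hf => by
    refine le_trans ?_ (hle a b ha)
    rw [← hI]
    gcongr
    exact abs_integral_trig_le hw (by fun_prop) hf
  have hpow : ∀ θ, s * symbol θ * gauss s θ ≤ 49 * gauss (s / 2) θ := fun θ => by
    have h2 := pow_symbol_mul_gauss_le hs.le θ (k := 2) (by norm_num)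
    rwa [mul_pow, sq_sqrt hs.le, sq_sqrt (symbol_nonneg θ)] at h2
  have hsd : ∀ f : ℝ → ℝ, s * |∫ θ in -π..π, cos (n * θ) * f θ| =
      |∫ θ in -π..π, cos (n * θ) * (s * f θ)| := fun f => by
    rw [← abs_of_pos hs, ← abs_mul, abs_of_pos hs, ← intervalIntegral.integral_const_mul]
    simp only [mul_left_comm]
  have hd : s * |kernelDiff n s| =
      (2 * π)⁻¹ * |∫ θ in -π..π, cos (n * θ) * (s * (symbol θ * gauss s θ))| := by
    rw [kernelDiff_eq, abs_neg, habs, mul_left_comm, hsd]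
  refine ⟨?_, ?_, ?_, ?_, ?_, ?_⟩
  · unfold kernel
    rw [habs]
    exact hone _ fun θ => by
      rw [abs_of_pos (gauss_pos _ _)]; exact gauss_le_one hs.le θ
  · have : |kernel n s| ≤ 49 * I + 0 := by
      unfold kernel
      rw [habs]
      refine hlin _ _ 49 0 (by norm_num) hcos fun θ => ?_
      rw [abs_of_pos (gauss_pos _ _), add_zero]
      simpa using pow_symbol_mul_gauss_le hs.le θ (k := 0) (by norm_num)
    calc _ ≤ √s * (49 * I + 0) := by gcongr
      _ = 49 * (√s * I) := by ring
      _ ≤ 49 * Γ := by gcongr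
      _ ≤ _ := by linarith
  · rw [← abs_pow, ← abs_mul, kernel_third_moment, habs]
    refine (hlin _ _ _ _ (by positivity) hsin fun θ => kernel_third_integrand_le hs.le θ).trans ?_
    calc _ = s * (980 * (√s * I) + 2) := by ring
      _ ≤ s * (980 * Γ + 2) := by gcongr
      _ ≤ _ := by nlinarith
  -- The constant 1 comes from `x exp (-x) ≤ 1` at `x = s * symbol θ`.
  · rw [hd]
    refine hone _ fun θ => ?_
    rw [← mul_assoc, abs_of_nonneg
      (mul_nonneg (mul_nonneg hs.le (symbol_nonneg θ)) (gauss_pos _ _).le)]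
    unfold gauss
    rw [exp_neg, ← div_eq_mul_inv, div_le_one (exp_pos _)]
    linarith [add_one_le_exp (s * symbol θ)]
  · have : s * |kernelDiff n s| ≤ 49 * I + 0 := by
      rw [hd]
      refine hlin _ _ 49 0 (by norm_num) hcos fun θ => ?_
      rw [← mul_assoc, abs_of_nonneg
        (mul_nonneg (mul_nonneg hs.le (symbol_nonneg θ)) (gauss_pos _ _).le), add_zero]
      exact hpow θ
    calc _ = √s * (s * |kernelDiff n s|) := by ring
      _ ≤ √s * (49 * I + 0) := by gcongr
      _ = 49 * (√s * I) := by ring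
      _ ≤ 49 * Γ := by gcongr
      _ ≤ _ := by linarith
  · rw [← abs_pow, ← abs_mul, kernelDiff_third_moment, abs_neg, habs]
    refine (hlin _ _ _ _ (by positivity) hsin
      fun θ => kernelDiff_third_integrand_le hs.le θ).trans ?_
    calc _ = 3332 * (√s * I) + 100 := by ring
      _ ≤ _ := by gcongr

/-! ### Product formula for the heat kernel and the error kernel -/

theorem fwdDiff_bwdDiff_prod {d : ℕ} (h C : ℝ) (g : Fin d → ℤ → ℝ) (j : Fin d)
    (α : Fin d → ℤ) :
    fwdDiff h j (bwdDiff h j fun γ => C * ∏ i, g i (γ i)) α =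
      C * ((g j (α j + 1) - 2 * g j (α j) + g j (α j - 1)) / h ^ 2 *
        ∏ i ∈ Finset.univ.erase j, g i (α i)) := by
  have e : ∀ γ : Fin d → ℤ, (∀ i, i ≠ j → γ i = α i) →
      ∏ i, g i (γ i) = g j (γ j) * ∏ i ∈ Finset.univ.erase j, g i (α i) := fun γ hγ => by
    rw [← Finset.mul_prod_erase _ _ (Finset.mem_univ j)]
    congr 1
    exact Finset.prod_congr rfl fun i hi => by rw [hγ i (Finset.ne_of_mem_erase hi)]
  simp only [fwdDiff, bwdDiff, add_sub_cancel_right]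
  rw [e (α + Pi.single j 1) (fun i hi => by simp [hi]), e α (fun i _ => rfl),
    e (α - Pi.single j 1) (fun i hi => by simp [hi])]
  simp only [Pi.add_apply, Pi.sub_apply, Pi.single_eq_same]
  rw [← sub_div, div_div, ← pow_two]
  ring

/-- By the Leibniz rule the time derivative is a sum over directions in which one factor is replaced
by `κ j / h²` times its second difference, which is `constOp` applied to the product. -/
theorem isFundamentalSolution_prod_kernel {d : ℕ} {h : ℝ} {κ : Fin d → ℝ}
    (hκ : ∀ i, 0 ≤ κ i) (hb : ∀ (n : ℤ) (s : ℝ), 0 ≤ s → |kernel n s| ≤ 1) :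
    IsFundamentalSolution h κ
      (fun t γ => (h ^ d)⁻¹ * ∏ i, kernel (γ i) (κ i * t / h ^ 2)) := by
  have hder : ∀ t α, HasDerivAt
      (fun t => (h ^ d)⁻¹ * ∏ i, kernel (α i) (κ i * t / h ^ 2))
      (constOp h κ (fun γ => (h ^ d)⁻¹ * ∏ i, kernel (γ i) (κ i * t / h ^ 2)) α) t := by
    intro t α
    have h1 : ∀ i ∈ Finset.univ, HasDerivAt (fun t => kernel (α i) (κ i * t / h ^ 2))
        (kernelDiff (α i) (κ i * t / h ^ 2) * (κ i / h ^ 2)) t := fun i _ => by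
      have h2 : HasDerivAt (fun t => κ i * t / h ^ 2) (κ i / h ^ 2) t := by
        simpa using ((hasDerivAt_id t).const_mul (κ i)).div_const (h ^ 2)
      exact HasDerivAt.comp (h₂ := kernel (α i)) t (hasDerivAt_kernel _ _) h2
    refine ((HasDerivAt.fun_finsetProd h1).const_mul ((h ^ d)⁻¹)).congr_deriv ?_
    unfold constOp
    rw [Finset.mul_sum]
    refine Finset.sum_congr rfl fun j _ => ?_
    rw [fwdDiff_bwdDiff_prod h _ (fun i n => kernel n (κ i * t / h ^ 2)) j α, smul_eq_mul]
    unfold kernelDiff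
    ring
  refine ⟨fun α => ?_, fun α t _ => (hder t α).continuousAt.continuousWithinAt,
    fun t _ α => hder t α, fun T => ⟨|(h ^ d)⁻¹|, fun t ht α => ?_⟩⟩
  · simp only [mul_zero, zero_div, kernel_zero, dirac, Finset.prod_ite_zero, funext_iff]
    simp
  · rw [abs_mul, Finset.abs_prod]
    refine mul_le_of_le_one_right (abs_nonneg _)
      (Finset.prod_le_one (fun i _ => abs_nonneg _) fun i _ => hb _ _ ?_)
    exact div_nonneg (mul_nonneg (hκ i) ht.1) (sq_nonneg h)

theorem abs_kernel_le_one (n : ℤ) {s : ℝ} (hs : 0 ≤ s) : |kernel n s| ≤ 1 := by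
  rcases hs.eq_or_lt with rfl | hs
  · rw [kernel_zero]; split_ifs <;> simp
  · obtain ⟨C, -, hC⟩ := exists_kernel_bounds
    exact (hC n s hs).1

theorem heatKernel_eq {d : ℕ} (h : ℝ) {κ : Fin d → ℝ} (hκ : ∀ i, 0 ≤ κ i) {t : ℝ}
    (ht : 0 ≤ t) (γ : Fin d → ℤ) :
    heatKernel h κ t γ = (h ^ d)⁻¹ * ∏ i, kernel (γ i) (κ i * t / h ^ 2) :=
  (heatKernel_spec h κ).unique
    (isFundamentalSolution_prod_kernel hκ fun n _ hs => abs_kernel_le_one n hs) t ht γ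

theorem errorKernel_eq {d : ℕ} (h : ℝ) {c : (Fin d → ℤ) → Fin d → ℝ} (α β : Fin d → ℤ)
    (hc : ∀ i, 0 ≤ c β i) {t : ℝ} (ht : 0 ≤ t) :
    errorKernel h c α β t = ∑ j, (c α j - c β j) * ((h ^ d)⁻¹ *
      (kernelDiff ((α - β) j) (c β j * t / h ^ 2) / h ^ 2 *
        ∏ i ∈ Finset.univ.erase j, kernel ((α - β) i) (c β i * t / h ^ 2))) := by
  unfold errorKernel
  refine Finset.sum_congr rfl fun j _ => ?_
  simp only [heatKernel_eq h hc ht, Pi.sub_apply]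
  rw [fwdDiff_bwdDiff_prod h _ (fun i n => kernel (n - β i) (c β i * t / h ^ 2)) j α]
  unfold kernelDiff
  rw [add_sub_right_comm, sub_right_comm]

/-! ### Weighted one-dimensional bounds -/

/-- The factor by which the heat kernel bound improves in a direction without displacement. -/
noncomputable def zeroWeight (b T : ℝ) (n : ℤ) : ℝ := if n = 0 then min (1 / √(2 * b)) T else 1

/-- The square root of the algebraic tail weight in one direction. -/
noncomputable def tailWeight (b T : ℝ) (n : ℤ) : ℝ := √(1 + (n : ℝ) ^ 2 / (2 * b * T ^ 2))

theorem one_le_tailWeight {b : ℝ} (hb : 0 ≤ b) (T : ℝ) (n : ℤ) : 1 ≤ tailWeight b T n := by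
  rw [tailWeight, one_le_sqrt]
  have : 0 ≤ (n : ℝ) ^ 2 / (2 * b * T ^ 2) := by positivity
  linarith

theorem tailWeight_sq {b : ℝ} (hb : 0 ≤ b) (T : ℝ) (n : ℤ) :
    tailWeight b T n ^ 2 = 1 + (n : ℝ) ^ 2 / (2 * b * T ^ 2) :=
  sq_sqrt (by positivity)

/-- For `n = 0` the tail weight is 1 and the bounds `C` and `C T` serve the two branches of the
minimum; `√(2M)` in the constant pays for the first. For `n ≠ 0` the cube is expanded by `(1 + x)³ ≤
4 (1 + x³)`, and the third moment cancels the `T³` in the denominator. -/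
theorem mul_tailWeight_pow_three_le {m M b T C Y : ℝ} {n : ℤ} (hm : 0 < m) (hmb : m ≤ b)
    (hbM : b ≤ M) (hT : 0 < T) (hC : 0 ≤ C) (hY : 0 ≤ Y) (h1 : Y ≤ C) (h2 : Y ≤ C * T)
    (h3 : |(n : ℝ)| ^ 3 * Y ≤ C * T ^ 3) :
    Y * tailWeight b T n ^ 3 ≤
      C * (5 + √(2 * M) + 4 / √(2 * m) ^ 3) * zeroWeight b T n := by
  have hb : 0 < b := hm.trans_le hmb
  have sm : 0 < √(2 * m) := sqrt_pos.2 (by linarith)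
  have sb : 0 < √(2 * b) := sqrt_pos.2 (by linarith)
  have hmb' : √(2 * m) ≤ √(2 * b) := sqrt_le_sqrt (by linarith)
  have hbM' : √(2 * b) ≤ √(2 * M) := sqrt_le_sqrt (by linarith)
  have hdiv : 0 ≤ 4 / √(2 * m) ^ 3 := by positivity
  unfold zeroWeight
  split_ifs with hn
  · have : tailWeight b T n = 1 := by simp [tailWeight, hn]
    rw [this, one_pow, mul_one]
    rcases min_choice (1 / √(2 * b)) T with h | h <;> rw [h]
    · rw [mul_one_div, le_div_iff₀ sb]
      calc Y * √(2 * b) ≤ C * √(2 * M) := by gcongr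
        _ ≤ _ := by gcongr; linarith
    · refine h2.trans ?_
      gcongr
      exact le_mul_of_one_le_right hC (by linarith [sqrt_nonneg (2 * M)])
  · have hR : tailWeight b T n ≤ 1 + |(n : ℝ)| / (√(2 * b) * T) := by
      refine sqrt_le_iff.2 ⟨by positivity, ?_⟩
      have : (n : ℝ) ^ 2 / (2 * b * T ^ 2) = (|(n : ℝ)| / (√(2 * b) * T)) ^ 2 := by
        rw [div_pow, mul_pow, sq_sqrt (by linarith), sq_abs]
      rw [this]
      nlinarith [show 0 ≤ |(n : ℝ)| / (√(2 * b) * T) by positivity]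
    have hcube : ∀ x : ℝ, 0 ≤ x → (1 + x) ^ 3 ≤ 4 * (1 + x ^ 3) := fun x hx => by
      nlinarith [mul_nonneg (by linarith : 0 ≤ 1 + x) (sq_nonneg (1 - x))]
    have hR0 : 0 ≤ tailWeight b T n := sqrt_nonneg _
    rw [mul_one]
    calc Y * tailWeight b T n ^ 3 ≤ Y * (1 + |(n : ℝ)| / (√(2 * b) * T)) ^ 3 := by gcongr
      _ ≤ Y * (4 * (1 + (|(n : ℝ)| / (√(2 * b) * T)) ^ 3)) := by
        gcongr
        exact hcube _ (by positivity)
      _ = 4 * Y + 4 * (|(n : ℝ)| ^ 3 * Y) / (√(2 * b) * T) ^ 3 := by ring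
      _ ≤ 4 * C + 4 * (C * T ^ 3) / (√(2 * b) * T) ^ 3 := by gcongr
      _ = 4 * C + C * (4 / √(2 * b) ^ 3) := by field_simp
      _ ≤ 4 * C + C * (4 / √(2 * m) ^ 3) := by gcongr
      _ ≤ _ := by nlinarith [mul_nonneg hC (sqrt_nonneg (2 * M))]

/-- The weights carry `b`, later the supremum of the coefficients, while the kernel runs at the
frozen speed `κ`. Both lie in `[m, M]`, so the mismatch costs only a constant. -/
theorem exists_weighted_kernel_bounds {m M : ℝ} (hm : 0 < m) (hmM : m ≤ M) :
    ∃ C : ℝ, 0 < C ∧ ∀ (b κ T : ℝ) (n : ℤ), m ≤ b → b ≤ M → m ≤ κ → κ ≤ M → 0 < T →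
      T * |kernel n (κ * T ^ 2)| * tailWeight b T n ^ 3 ≤ C * zeroWeight b T n ∧
      T ^ 3 * |kernelDiff n (κ * T ^ 2)| * tailWeight b T n ^ 3 ≤ C * zeroWeight b T n := by
  obtain ⟨C, hC1, hC⟩ := exists_kernel_bounds
  have hM : 0 < M := hm.trans_le hmM
  have sm : 0 < √m := sqrt_pos.2 hm
  have p1 : 0 < 1 / √m := by positivity
  have p2 : 0 < 1 / m := by positivity
  have p3 : 0 < 1 / (m * √m) := by positivity
  -- One summand for each way of removing `κ`: `M` from the third moment of the kernel, the inverse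
  -- powers of `m` from `√s`, `s` and `s √s`, and 1 where no `κ` appears.
  set D := C * (1 + M + 1 / √m + 1 / m + 1 / (m * √m)) with hD
  have hC0 : 0 < C := by linarith
  have hD0 : 0 < D := by positivity
  have hD1 : C ≤ D := le_mul_of_one_le_right hC0.le (by linarith)
  have hD2 : C * M ≤ D := by rw [hD]; gcongr; linarith
  have hD3 : C * (1 / √m) ≤ D := by rw [hD]; gcongr; linarith
  have hD4 : 1 / m ≤ D := by
    calc 1 / m ≤ C * (1 / m) := le_mul_of_one_le_left p2.le hC1
      _ ≤ D := by rw [hD]; gcongr; linarith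
  have hD5 : C * (1 / (m * √m)) ≤ D := by rw [hD]; gcongr; linarith
  refine ⟨D * (5 + √(2 * M) + 4 / √(2 * m) ^ 3), by positivity,
    fun b κ T n hmb hbM hmκ hκM hT => ?_⟩
  have hκ : 0 < κ := hm.trans_le hmκ
  have hsκ : √m ≤ √κ := sqrt_le_sqrt hmκ
  have hs : √(κ * T ^ 2) = √κ * T := by rw [sqrt_mul hκ.le, sqrt_sq hT.le]
  obtain ⟨b1, b2, b3, b4, b5, b6⟩ := hC n (κ * T ^ 2) (by positivity)
  rw [hs] at b2 b5
  set P := |kernel n (κ * T ^ 2)|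
  set Q := |kernelDiff n (κ * T ^ 2)|
  have hP : 0 ≤ P := abs_nonneg _
  have hQ : 0 ≤ Q := abs_nonneg _
  constructor
  · refine mul_tailWeight_pow_three_le hm hmb hbM hT hD0.le (by positivity) ?_ ?_ ?_
    · refine le_trans ?_ hD3
      rw [mul_one_div, le_div_iff₀ sm]
      calc T * P * √m ≤ T * P * √κ := by gcongr
        _ = √κ * T * P := by ring
        _ ≤ C := b2
    · calc T * P ≤ T * 1 := by gcongr
        _ = 1 * T := by ring
        _ ≤ D * T := by gcongr; linarith
    · calc |(n : ℝ)| ^ 3 * (T * P) = T * (|(n : ℝ)| ^ 3 * P) := by ring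
        _ ≤ T * (C * (κ * T ^ 2)) := by gcongr
        _ ≤ T * (C * (M * T ^ 2)) := by gcongr
        _ = C * M * T ^ 3 := by ring
        _ ≤ D * T ^ 3 := by gcongr
  · refine mul_tailWeight_pow_three_le hm hmb hbM hT hD0.le (by positivity) ?_ ?_ ?_
    · refine le_trans ?_ hD5
      rw [mul_one_div, le_div_iff₀ (by positivity)]
      calc T ^ 3 * Q * (m * √m) ≤ T ^ 3 * Q * (κ * √κ) := by gcongr
        _ = κ * T ^ 2 * (√κ * T) * Q := by ring
        _ ≤ C := b5
    · have : T ^ 2 * Q ≤ 1 / m := by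
        rw [le_div_iff₀ hm]
        calc T ^ 2 * Q * m ≤ T ^ 2 * Q * κ := by gcongr
          _ = κ * T ^ 2 * Q := by ring
          _ ≤ 1 := b4
      calc T ^ 3 * Q = T ^ 2 * Q * T := by ring
        _ ≤ D * T := by gcongr; linarith
    · calc |(n : ℝ)| ^ 3 * (T ^ 3 * Q) = |(n : ℝ)| ^ 3 * Q * T ^ 3 := by ring
        _ ≤ D * T ^ 3 := by gcongr; linarith

/-! ### Assembly over the coordinates -/

theorem prod_zeroWeight {d : ℕ} (b T : ℝ) (γ : Fin d → ℤ) :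
    ∏ i, zeroWeight b T (γ i) = min (1 / √(2 * b)) T ^ numZeros γ := by
  simp only [zeroWeight, numZeros, Finset.prod_ite, Finset.prod_const, one_pow, mul_one]

/-- Each coordinate of the displacement is at most `√(2b) T h` times its own tail weight, and a
single weight is at most the product since all are at least 1. -/
theorem norm_gridPoint_sub_le {d : ℕ} {h b T : ℝ} (hh : 0 < h) (hb : 0 < b) (hT : 0 < T)
    (α β : Fin d → ℤ) :
    ‖gridPoint h α - gridPoint h β‖ ≤
      √d * √(2 * b) * (T * h) * ∏ i, tailWeight b T ((α - β) i) := by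
  have hR : ∀ i, 1 ≤ tailWeight b T ((α - β) i) := fun i => one_le_tailWeight hb.le T _
  have hR0 : ∀ i, 0 ≤ tailWeight b T ((α - β) i) := fun i => zero_le_one.trans (hR i)
  have hP0 : 0 ≤ ∏ i, tailWeight b T ((α - β) i) := Finset.prod_nonneg fun i _ => hR0 i
  refine abs_le_of_sq_le_sq' ?_ (by positivity) |>.2
  rw [EuclideanSpace.norm_sq_eq]
  have hterm : ∀ k ∈ Finset.univ, ‖(gridPoint h α - gridPoint h β) k‖ ^ 2 ≤
      2 * b * (T * h) ^ 2 * (∏ i, tailWeight b T ((α - β) i)) ^ 2 := fun k _ => by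
    have hk : tailWeight b T ((α - β) k) ≤ ∏ i, tailWeight b T ((α - β) i) := by
      rw [← Finset.mul_prod_erase _ _ (Finset.mem_univ k)]
      exact le_mul_of_one_le_right (hR0 k) (Finset.prod_induction _ (1 ≤ ·)
        (fun _ _ => one_le_mul_of_one_le_of_one_le) le_rfl fun i _ => hR i)
    have e : ‖(gridPoint h α - gridPoint h β) k‖ ^ 2 =
        2 * b * (T * h) ^ 2 * ((((α - β) k : ℤ) : ℝ) ^ 2 / (2 * b * T ^ 2)) := by
      rw [Real.norm_eq_abs, sq_abs]
      simp only [gridPoint, PiLp.sub_apply, Pi.sub_apply]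
      push_cast
      field_simp
    rw [e]
    gcongr
    calc _ ≤ tailWeight b T ((α - β) k) ^ 2 := by rw [tailWeight_sq hb.le]; linarith
      _ ≤ _ := by gcongr; exact hR0 k
  refine (Finset.sum_le_card_nsmul _ _ _ hterm).trans (le_of_eq ?_)
  rw [Finset.card_univ, Fintype.card_fin, nsmul_eq_mul, mul_pow _ (∏ i, _),
    mul_pow _ (T * h), mul_pow (√_), sq_sqrt (Nat.cast_nonneg d), sq_sqrt (by linarith)]
  ring

theorem supNorm_mem_Icc {d : ℕ} [Nonempty (Fin d)] {m M : ℝ} {c : (Fin d → ℤ) → Fin d → ℝ}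
    (hm : 0 < m) (hc1 : ∀ α j, m ≤ c α j) (hc2 : ∀ α j, c α j ≤ M) :
    m ≤ supNorm c ∧ supNorm c ≤ M := by
  have habs : ∀ p : (Fin d → ℤ) × Fin d, |c p.1 p.2| ≤ M := fun p => by
    rw [abs_of_pos (hm.trans_le (hc1 _ _))]; exact hc2 _ _
  let p : (Fin d → ℤ) × Fin d := (0, Classical.arbitrary _)
  refine ⟨((hc1 p.1 p.2).trans (le_abs_self _)).trans
    (le_ciSup (f := fun p : (Fin d → ℤ) × Fin d => |c p.1 p.2|) ⟨M, ?_⟩ p), ciSup_le habs⟩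
  rintro _ ⟨q, rfl⟩
  exact habs q

theorem abs_kernelDiff_mul_prod_le {d : ℕ} {b T C : ℝ} {κ : Fin d → ℝ} (γ : Fin d → ℤ)
    (hb : 0 ≤ b) (hT : 0 < T)
    (hP : ∀ i, T * |kernel (γ i) (κ i * T ^ 2)| * tailWeight b T (γ i) ^ 3 ≤
      C * zeroWeight b T (γ i))
    (hD : ∀ i, T ^ 3 * |kernelDiff (γ i) (κ i * T ^ 2)| * tailWeight b T (γ i) ^ 3 ≤
      C * zeroWeight b T (γ i)) (j : Fin d) :
    |kernelDiff (γ j) (κ j * T ^ 2)| *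
        |∏ i ∈ Finset.univ.erase j, kernel (γ i) (κ i * T ^ 2)| ≤
      C ^ d * min (1 / √(2 * b)) T ^ numZeros γ / T ^ (d + 2) *
        ((∏ i, tailWeight b T (γ i)) ^ 3)⁻¹ := by
  have hR : ∀ i, 0 < tailWeight b T (γ i) := fun i =>
    one_pos.trans_le (one_le_tailWeight hb T _)
  have hRp : 0 < ∏ i, tailWeight b T (γ i) := Finset.prod_pos fun i _ => hR i
  rw [← div_eq_mul_inv, le_div_iff₀ (by positivity), le_div_iff₀ (by positivity)]
  -- Three powers of `T` go to the differenced factor and one to each of the other `d - 1`.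
  have hcard : T ^ (d + 2) = T ^ 3 * ∏ i ∈ Finset.univ.erase j, T := by
    have hd : d = d - 1 + 1 := (Nat.succ_pred_eq_of_pos j.pos).symm
    rw [Finset.prod_const, Finset.card_erase_of_mem (Finset.mem_univ j), Finset.card_univ,
      Fintype.card_fin, ← pow_add]
    congr 1
    omega
  calc _ = T ^ 3 * |kernelDiff (γ j) (κ j * T ^ 2)| * tailWeight b T (γ j) ^ 3 *
        ∏ i ∈ Finset.univ.erase j,
          (T * |kernel (γ i) (κ i * T ^ 2)| * tailWeight b T (γ i) ^ 3) := by
        rw [hcard, Finset.prod_mul_distrib, Finset.prod_mul_distrib, Finset.prod_pow,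
          Finset.abs_prod, ← Finset.mul_prod_erase _ _ (Finset.mem_univ j)]
        ring
    _ ≤ C * zeroWeight b T (γ j) *
        ∏ i ∈ Finset.univ.erase j, (C * zeroWeight b T (γ i)) := by
      have h0 : ∀ i, 0 ≤ T * |kernel (γ i) (κ i * T ^ 2)| * tailWeight b T (γ i) ^ 3 :=
        fun i => by have := hR i; positivity
      refine mul_le_mul (hD j) (Finset.prod_le_prod (fun i _ => h0 i) fun i _ => hP i)
        (Finset.prod_nonneg fun i _ => h0 i) ?_
      exact (h0 j).trans (hP j)
    _ = _ := by
      rw [Finset.mul_prod_erase _ (fun i => C * zeroWeight b T (γ i)) (Finset.mem_univ j),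
        Finset.prod_mul_distrib, prod_zeroWeight, Finset.prod_const, Finset.card_univ,
        Fintype.card_fin]

theorem abs_errorKernel_le {d : ℕ} {h b L T C M : ℝ} {c : (Fin d → ℤ) → Fin d → ℝ}
    {α β : Fin d → ℤ} (hh : 0 < h) (hb : 0 < b) (hbM : b ≤ M) (hT : 0 < T)
    (hc : ∀ i, 0 ≤ c β i)
    (hL : ∀ j, |c α j - c β j| ≤ L * ‖gridPoint h α - gridPoint h β‖)
    (hP : ∀ i, T * |kernel ((α - β) i) (c β i * T ^ 2)| * tailWeight b T ((α - β) i) ^ 3 ≤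
      C * zeroWeight b T ((α - β) i))
    (hD : ∀ i, T ^ 3 * |kernelDiff ((α - β) i) (c β i * T ^ 2)| *
      tailWeight b T ((α - β) i) ^ 3 ≤ C * zeroWeight b T ((α - β) i)) :
    |errorKernel h c α β ((T * h) ^ 2)| ≤
      d * (|L| * (√d * √(2 * M)) * C ^ d) * min (1 / √(2 * b)) T ^ numZeros (α - β) *
        ((T * h) ^ (d + 1))⁻¹ *
        ∏ i, (1 + (((α - β) i : ℤ) : ℝ) ^ 2 / (2 * b * T ^ 2))⁻¹ := by
  have ht : ∀ i, c β i * (T * h) ^ 2 / h ^ 2 = c β i * T ^ 2 := fun i => by field_simp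
  have hR : ∀ i, 0 < tailWeight b T ((α - β) i) := fun i =>
    one_pos.trans_le (one_le_tailWeight hb.le T _)
  have hRp : 0 < ∏ i, tailWeight b T ((α - β) i) := Finset.prod_pos fun i _ => hR i
  have hR2 : ∏ i, (1 + (((α - β) i : ℤ) : ℝ) ^ 2 / (2 * b * T ^ 2))⁻¹ =
      ((∏ i, tailWeight b T ((α - β) i)) ^ 2)⁻¹ := by
    rw [Finset.prod_inv_distrib, ← Finset.prod_pow]
    simp only [tailWeight_sq hb.le]
  rw [hR2, errorKernel_eq h α β hc (sq_nonneg _)]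
  simp only [ht]
  have hN := norm_gridPoint_sub_le hh hb hT α β
  set R := ∏ i, tailWeight b T ((α - β) i)
  set ω := min (1 / √(2 * b)) T ^ numZeros (α - β)
  have hj : ∀ j ∈ Finset.univ, |(c α j - c β j) * ((h ^ d)⁻¹ *
      (kernelDiff ((α - β) j) (c β j * T ^ 2) / h ^ 2 *
        ∏ i ∈ Finset.univ.erase j, kernel ((α - β) i) (c β i * T ^ 2)))| ≤
      |L| * (√d * √(2 * M)) * C ^ d * ω * ((T * h) ^ (d + 1))⁻¹ * (R ^ 2)⁻¹ := fun j _ => by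
    have key := abs_kernelDiff_mul_prod_le (α - β) hb.le hT hP hD j
    have hLj : |c α j - c β j| ≤ |L| * (√d * √(2 * M) * (T * h) * R) := by
      refine (hL j).trans (mul_le_mul (le_abs_self L) (hN.trans ?_) (norm_nonneg _)
        (abs_nonneg L))
      gcongr
    rw [abs_mul, abs_mul, abs_mul, abs_div, abs_of_pos (by positivity : 0 < (h ^ d)⁻¹),
      abs_of_pos (by positivity : 0 < h ^ 2)]
    calc _ = |c α j - c β j| * ((h ^ (d + 2))⁻¹ *
          (|kernelDiff ((α - β) j) (c β j * T ^ 2)| *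
            |∏ i ∈ Finset.univ.erase j, kernel ((α - β) i) (c β i * T ^ 2)|)) := by
          rw [pow_add, mul_inv]; ring
      -- The Lipschitz factor `T h R` lowers `(T h)^(-(d+2))` to `(T h)^(-(d+1))` and `R⁻³` to
      -- `R⁻²`.
      _ ≤ |L| * (√d * √(2 * M) * (T * h) * R) * ((h ^ (d + 2))⁻¹ *
          (C ^ d * ω / T ^ (d + 2) * (R ^ 3)⁻¹)) := by gcongr
      _ = _ := by field_simp; ring
  refine (Finset.abs_sum_le_sum_abs _ _).trans ((Finset.sum_le_card_nsmul _ _ _ hj).trans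
    (le_of_eq ?_))
  rw [Finset.card_univ, Fintype.card_fin, nsmul_eq_mul]
  ring

end SemiDiscreteHeat

/-! ### Main theorem -/

theorem mainTheorem8 (d : ℕ) (hd : 1 ≤ d) (m M L : ℝ) (hm : 0 < m) :
    ∃ A : ℝ, 0 < A ∧
      ∀ h : ℝ, 0 < h →
      ∀ c : (Fin d → ℤ) → Fin d → ℝ,
        (∀ α j, m ≤ c α j) →
        (∀ α j, c α j ≤ M) →
        (∀ α β j, |c α j - c β j| ≤
          L * ‖SemiDiscreteHeat.gridPoint h α - SemiDiscreteHeat.gridPoint h β‖) →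
        ∀ (α β : Fin d → ℤ) (t : ℝ), 0 < t →
          |SemiDiscreteHeat.errorKernel h c α β t| ≤
            A * min (1 / √(2 * SemiDiscreteHeat.supNorm c)) (t ^ (1 / 2 : ℝ) / h) ^
                  SemiDiscreteHeat.numZeros (α - β) *
              t ^ (-((d : ℝ) + 1) / 2) *
              ∏ j, (1 + |SemiDiscreteHeat.gridPoint h α j -
                  SemiDiscreteHeat.gridPoint h β j| ^ 2 /
                (2 * SemiDiscreteHeat.supNorm c * t))⁻¹ := by
  have : Nonempty (Fin d) := ⟨⟨0, hd⟩⟩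
  -- If `M < m` no coefficient family is admissible, so any positive constant serves.
  rcases lt_or_ge M m with hMm | hmM
  · exact ⟨1, one_pos, fun h _ c hc1 hc2 => absurd
      ((hc1 0 (Classical.arbitrary _)).trans (hc2 0 _)) hMm.not_ge⟩
  obtain ⟨C, hC, hbounds⟩ := SemiDiscreteHeat.exists_weighted_kernel_bounds hm hmM
  -- The added 1 keeps the constant positive when `L = 0`.
  refine ⟨d * (|L| * (√d * √(2 * M)) * C ^ d) + 1, by positivity,
    fun h hh c hc1 hc2 hL α β t ht => ?_⟩
  obtain ⟨hb1, hb2⟩ := SemiDiscreteHeat.supNorm_mem_Icc hm hc1 hc2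
  have hb : 0 < SemiDiscreteHeat.supNorm c := hm.trans_le hb1
  have hst : 0 < √t := Real.sqrt_pos.2 ht
  -- The diffusion length in grid cells, chosen so that `(T h)² = t`.
  have hT : 0 < √t / h := by positivity
  have hTh : √t / h * h = √t := div_mul_cancel₀ _ hh.ne'
  have key := SemiDiscreteHeat.abs_errorKernel_le (c := c) (α := α) (β := β) hh hb hb2 hT
    (fun i => hm.le.trans (hc1 β i)) (hL α β)
    (fun i => (hbounds _ _ _ _ hb1 hb2 (hc1 β i) (hc2 β i) hT).1)
    (fun i => (hbounds _ _ _ _ hb1 hb2 (hc1 β i) (hc2 β i) hT).2)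
  have hpow : t ^ (-((d : ℝ) + 1) / 2) = (√t ^ (d + 1))⁻¹ := by
    rw [Real.sqrt_eq_rpow, ← Real.rpow_mul_natCast ht.le, ← Real.rpow_neg ht.le]
    congr 1
    push_cast
    ring
  have hprod : ∀ j, |SemiDiscreteHeat.gridPoint h α j - SemiDiscreteHeat.gridPoint h β j| ^ 2 /
      (2 * SemiDiscreteHeat.supNorm c * t) =
      (((α - β) j : ℤ) : ℝ) ^ 2 / (2 * SemiDiscreteHeat.supNorm c * (√t / h) ^ 2) := fun j => by
    rw [sq_abs, div_pow, Real.sq_sqrt ht.le]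
    simp only [SemiDiscreteHeat.gridPoint, Pi.sub_apply]
    push_cast
    field_simp
  rw [hTh, Real.sq_sqrt ht.le] at key
  rw [← Real.sqrt_eq_rpow, hpow]
  simp only [hprod]
  refine key.trans ?_
  gcongr
  linarith
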